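/- Let $a,b\ge 0$, $T_e<T_c$, $T_\delta=T_c-T_e$, $E\ge 0$ and $D>0$ be real constants. A transmitter has $E$ units of energy available at time $0$ and no later energy arrivals. A power policy is a measurable function $P:[0,D]\to[0,\infty)$; it generates the temperature $$T(t)=e^{-bt}\left(\int_0^t e^{b\tau}\,(aP(\tau)+bT_e)\,d\tau+T_e\right),\qquad t\in[0,D],$$ that is, the solution of $\frac{d}{dt}T(t)=aP(t)-b(T(t)-T_e)$ with $T(0)=T_e$. The policy is feasible if $\int_0^tP(\tau)\,d\tau\le E$ and $T(t)\le T_c$ for all $t\in[0,D]$, and it is optimal if it is feasible and maximizes the throughput $\int_0^D\frac12\log_2(1+P(\tau))\,d\tau$ among all feasible policies. Let $P$ be an optimal policy whose temperature $T$ attains the value $T_c$ on $[0,D]$, and let $t'=\min\{t\in[0,D]:T(t)=T_c\}$. If $t'<D$, then $$P(t)=\frac{T_\delta b}{a}\quad\text{for almost every }t\in[t',D],$$ and this equality holds at every $t\in[t',D]$ at which the restriction of $P$ to $[t',D]$ is continuous (hence for all $t\in[t',D]$ if $P$ is continuous there); moreover $T(t)=T_c$ for all $t\in[t',D]$. -/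

import Mathlib

open MeasureTheory Set

namespace HeatTx

/-- Temperature at time `t` of a transmitter with `dT/dt = a P - b (T - Te)` and `T(0) = Te`:
`T(t) = exp (-b t) (∫₀ᵗ exp (b τ) (a P(τ) + b Te) dτ + Te)`. -/
noncomputable def temperature (a b Te : ℝ) (P : ℝ → ℝ) (t : ℝ) : ℝ :=
  Real.exp (-(b * t)) * ((∫ τ in (0 : ℝ)..t, Real.exp (b * τ) * (a * P τ + b * Te)) + Te)

/-- The explicit formula does solve the thermal equation (almost everywhere, since `P` is only
integrable). -/
theorem temperature_ae_hasDerivAt (a b Te D : ℝ) (hD : 0 ≤ D) (P : ℝ → ℝ)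
    (hP : IntegrableOn P (Icc 0 D)) :
    temperature a b Te P 0 = Te ∧
      ∀ᵐ t ∂(volume.restrict (Icc 0 D)),
        HasDerivAt (temperature a b Te P) (a * P t - b * (temperature a b Te P t - Te)) t := by
  have hint : IntervalIntegrable (fun τ => Real.exp (b * τ) * (a * P τ + b * Te)) volume 0 D := by
    have h1 : IntervalIntegrable P volume 0 D :=
      (intervalIntegrable_iff_integrableOn_Icc_of_le hD).2 hP
    exact ((h1.const_mul a).add intervalIntegrable_const).continuousOn_mul
      (by fun_prop)
  refine ⟨by simp [temperature], ?_⟩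
  rw [ae_restrict_iff' measurableSet_Icc]
  filter_upwards [hint.ae_hasDerivAt_integral] with t ht htD
  rw [uIcc_of_le hD] at ht
  have h2 := ht htD 0 (left_mem_Icc.2 hD)
  have h3 : HasDerivAt (fun t : ℝ => Real.exp (-(b * t))) (Real.exp (-(b * t)) * -(b * 1)) t :=
    (((hasDerivAt_id t).const_mul b).neg).exp
  have h4 := h3.mul (h2.add_const Te)
  have h5 : Real.exp (-(b * t)) * Real.exp (b * t) = 1 := by
    rw [← Real.exp_add]; simp
  refine HasDerivAt.congr_deriv (f := temperature a b Te P) h4 ?_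
  simp only [temperature]
  linear_combination (a * P t + b * Te) * h5

/-- Feasible power policies on `[0, D]` when the energy `E` is available at time `0` and nothing
arrives later. Only the values of `P` on `[0, D]` matter. As `P ≥ 0` is measurable with
`∫ P ≤ E`, it is integrable; `integrable` records this so that the integrals have their usual
meaning. -/
structure IsFeasible (a b Te Tc E D : ℝ) (P : ℝ → ℝ) : Prop where
  integrable : IntegrableOn P (Icc 0 D)
  nonneg : ∀ t ∈ Icc 0 D, 0 ≤ P t
  energy : ∀ t ∈ Icc 0 D, (∫ τ in (0 : ℝ)..t, P τ) ≤ E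
  temp : ∀ t ∈ Icc 0 D, temperature a b Te P t ≤ Tc

/-- Number of bits sent over `[0, D]`. -/
noncomputable def throughput (D : ℝ) (P : ℝ → ℝ) : ℝ :=
  ∫ τ in (0 : ℝ)..D, (1 / 2 : ℝ) * Real.logb 2 (1 + P τ)

/-- Throughput-optimal feasible policies. -/
def IsOptimal (a b Te Tc E D : ℝ) (P : ℝ → ℝ) : Prop :=
  IsFeasible a b Te Tc E D P ∧
    ∀ Q : ℝ → ℝ, IsFeasible a b Te Tc E D Q → throughput D Q ≤ throughput D P

end HeatTx

namespace HeatTx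

/-! Let `c = (Tc - Te) * b / a` and let `s` be a time with temperature `Tc`. Heating up to `Tc`
requires power above `c`, so `M = ∫₀ˢ (P - c)⁺ > 0`; staying below `Tc` afterwards forces `e = ∫ₛᴰ
(P - c) ≤ 0`. Move `P` towards `c`: before `s` remove a fraction `θ` of the excess, after `s`
average with `c` at weight `ε`, choosing `ε > 0` so that the total energy is unchanged. This `shift`
stays feasible (`temperature_shift_le`). At equal energy, moving power towards a constant strictly
raises the throughput unless nothing changes (`IsOptimal.ae_eq_of_between`), so optimality forces `P
= c` almost everywhere after `s`. -/

/-! ### Temperature and exponentially weighted integrals. -/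

theorem intervalIntegrable_exp_mul {f : ℝ → ℝ} {s t : ℝ} (b : ℝ)
    (hf : IntervalIntegrable f volume s t) :
    IntervalIntegrable (fun τ => Real.exp (b * τ) * f τ) volume s t :=
  hf.continuousOn_mul (by fun_prop)

theorem integral_exp_mul_const (b c s t : ℝ) :
    (∫ τ in s..t, Real.exp (b * τ) * (b * c)) = c * (Real.exp (b * t) - Real.exp (b * s)) := by
  have h : ∀ x ∈ uIcc s t,
      HasDerivAt (fun τ : ℝ => c * Real.exp (b * τ)) (Real.exp (b * x) * (b * c)) x := by
    intro x _
    exact ((((hasDerivAt_id x).const_mul b).exp).const_mul c).congr_deriv (by simp; ring)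
  rw [intervalIntegral.integral_eq_sub_of_hasDerivAt h
    (Continuous.intervalIntegrable (by fun_prop) _ _)]
  ring

/-- The temperature excess over `Te` is the exponentially discounted heating. -/
theorem temperature_eq (a b Te : ℝ) {P : ℝ → ℝ} {t : ℝ} (hP : IntervalIntegrable P volume 0 t) :
    temperature a b Te P t =
      Te + Real.exp (-(b * t)) * (a * ∫ τ in (0 : ℝ)..t, Real.exp (b * τ) * P τ) := by
  have h1 : (∫ τ in (0 : ℝ)..t, Real.exp (b * τ) * (a * P τ + b * Te)) =
      a * (∫ τ in (0 : ℝ)..t, Real.exp (b * τ) * P τ) + Te * (Real.exp (b * t) - 1) := by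
    have h2 := integral_exp_mul_const b Te 0 t
    rw [mul_zero, Real.exp_zero] at h2
    rw [← h2, ← intervalIntegral.integral_const_mul, ← intervalIntegral.integral_add
      ((intervalIntegrable_exp_mul b hP).const_mul a)
      (Continuous.intervalIntegrable (by fun_prop) _ _)]
    congr 1
    ext τ
    ring
  have h5 : Real.exp (-(b * t)) * Real.exp (b * t) = 1 := by
    rw [← Real.exp_add]; simp
  rw [temperature, h1]
  linear_combination Te * h5

/-- Clearing the factor `exp (-(b * t))` leaves a constraint linear in `P` whose integrals can be
split at `s`. -/
theorem temperature_le_iff (a b Te Tc : ℝ) {P : ℝ → ℝ} {t : ℝ}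
    (hP : IntervalIntegrable P volume 0 t) :
    temperature a b Te P t ≤ Tc ↔
      a * (∫ τ in (0 : ℝ)..t, Real.exp (b * τ) * P τ) ≤ (Tc - Te) * Real.exp (b * t) := by
  rw [temperature_eq a b Te hP, Real.exp_neg, ← le_sub_iff_add_le', inv_mul_eq_div,
    div_le_iff₀ (Real.exp_pos _)]

theorem temperature_eq_iff (a b Te Tc : ℝ) {P : ℝ → ℝ} {t : ℝ}
    (hP : IntervalIntegrable P volume 0 t) :
    temperature a b Te P t = Tc ↔
      a * (∫ τ in (0 : ℝ)..t, Real.exp (b * τ) * P τ) = (Tc - Te) * Real.exp (b * t) := by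
  rw [temperature_eq a b Te hP, Real.exp_neg, ← eq_sub_iff_add_eq', inv_mul_eq_div,
    div_eq_iff (Real.exp_pos _).ne']

/-- If all partial integrals of `u` with the increasing weight `exp (b τ)` are nonpositive, so is
the unweighted integral. -/
theorem integral_nonpos_of_integral_exp_mul_nonpos {b s D : ℝ} (hb : 0 ≤ b) (hsD : s ≤ D)
    {u : ℝ → ℝ} (hu : IntervalIntegrable u volume s D)
    (h : ∀ t ∈ Icc s D, (∫ τ in s..t, Real.exp (b * τ) * u τ) ≤ 0) :
    (∫ τ in s..D, u τ) ≤ 0 := by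
  set G : ℝ → ℝ := fun t => ∫ τ in s..t, Real.exp (b * τ) * u τ with hG
  have hg := intervalIntegrable_exp_mul b hu
  have hGac : AbsolutelyContinuousOnInterval G s D :=
    hg.absolutelyContinuousOnInterval_intervalIntegral left_mem_uIcc
  have hfd : ∀ x, HasDerivAt (fun τ : ℝ => Real.exp (-(b * τ))) (-(b * Real.exp (-(b * x)))) x := by
    intro x
    exact (((hasDerivAt_id x).const_mul b).neg).exp.congr_deriv (by simp; ring)
  have hfac : AbsolutelyContinuousOnInterval (fun τ : ℝ => Real.exp (-(b * τ))) s D :=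
    ContDiffOn.absolutelyContinuousOnInterval (by fun_prop)
  -- Since `u = exp (-b τ) G'` almost everywhere, integration by parts leaves a boundary term and a
  -- remainder, both signed by `G ≤ 0`.
  have hparts := hfac.integral_mul_deriv_eq_deriv_mul hGac
  have h1 : (∫ x in s..D, Real.exp (-(b * x)) * deriv G x) = ∫ τ in s..D, u τ := by
    apply intervalIntegral.integral_congr_ae
    filter_upwards [hg.ae_hasDerivAt_integral] with x hx hxs
    rw [(hx (uIoc_subset_uIcc hxs) s left_mem_uIcc).deriv, ← mul_assoc, ← Real.exp_add]
    simp
  have h2 : 0 ≤ ∫ x in s..D, deriv (fun τ : ℝ => Real.exp (-(b * τ))) x * G x := by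
    apply intervalIntegral.integral_nonneg hsD
    intro x hx
    rw [(hfd x).deriv]
    exact mul_nonneg_of_nonpos_of_nonpos
      (neg_nonpos.2 (mul_nonneg hb (Real.exp_pos _).le)) (h x hx)
  have h3 : G s = 0 := by simp [hG]
  have h4 : Real.exp (-(b * D)) * G D ≤ 0 :=
    mul_nonpos_of_nonneg_of_nonpos (Real.exp_pos _).le (h D (right_mem_Icc.2 hsD))
  rw [h1, h3, mul_zero, sub_zero] at hparts
  linarith

/-! ### Strict concavity of the throughput. -/

/-- `log (1 + x) - x / (1 + c)` is concave with its unique maximum at `c`: it increases strictly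
when `x` moves towards `c`. -/
theorem sub_div_lt_log_sub_log {x c w : ℝ} (hx : 0 ≤ x) (hc : 0 ≤ c) (hw0 : 0 < w) (hw1 : w ≤ 1)
    (hxc : x ≠ c) :
    w * (c - x) / (1 + c) < Real.log (1 + (x + w * (c - x))) - Real.log (1 + x) := by
  have h1x : 0 < 1 + x := by linarith
  have h1c : 0 < 1 + c := by linarith
  have h1 := strictConcaveOn_log_Ioi.concaveOn.2 (mem_Ioi.2 h1x) (mem_Ioi.2 h1c)
    (sub_nonneg.2 hw1) hw0.le (by ring)
  have h2 : (1 - w) • (1 + x) + w • (1 + c) = 1 + (x + w * (c - x)) := by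
    simp only [smul_eq_mul]; ring
  rw [h2] at h1
  simp only [smul_eq_mul] at h1
  have h3 : Real.log ((1 + x) / (1 + c)) < (1 + x) / (1 + c) - 1 := by
    apply Real.log_lt_sub_one_of_pos (by positivity)
    intro h
    rw [div_eq_one_iff_eq h1c.ne'] at h
    exact hxc (by linarith)
  rw [Real.log_div h1x.ne' h1c.ne'] at h3
  have h4 : (1 + x) / (1 + c) - 1 = -((c - x) / (1 + c)) := by
    field_simp; ring
  rw [h4] at h3
  have h5 := mul_lt_mul_of_pos_left h3 hw0
  rw [mul_div_assoc]
  nlinarith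

theorem integrableOn_log_one_add {D : ℝ} {P : ℝ → ℝ} (hP : IntegrableOn P (Icc 0 D))
    (h0 : ∀ t ∈ Icc 0 D, 0 ≤ P t) :
    IntegrableOn (fun t => Real.log (1 + P t)) (Icc 0 D) := by
  refine Integrable.mono' hP ?_ ?_
  · exact (Real.measurable_log.comp_aemeasurable
      (hP.aemeasurable.const_add 1)).aestronglyMeasurable
  · refine (ae_restrict_mem measurableSet_Icc).mono fun t ht => ?_
    have := h0 t ht
    rw [Real.norm_eq_abs, abs_of_nonneg (Real.log_nonneg (by linarith))]
    have := Real.log_le_sub_one_of_pos (show 0 < 1 + P t by linarith)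
    linarith

/-- A feasible policy of the same energy which is pointwise between an optimal policy and a
constant agrees with the optimal policy. -/
theorem IsOptimal.ae_eq_of_between {a b Te Tc E D : ℝ} (hD : 0 ≤ D) {P Q : ℝ → ℝ}
    (hP : IsOptimal a b Te Tc E D P) (hQ : IsFeasible a b Te Tc E D Q)
    (hPQ : (∫ τ in (0 : ℝ)..D, Q τ) = ∫ τ in (0 : ℝ)..D, P τ) {c : ℝ} (hc : 0 ≤ c)
    (hw : ∀ t ∈ Icc 0 D, ∃ w ∈ Icc (0 : ℝ) 1, Q t = P t + w * (c - P t)) :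
    Q =ᵐ[volume.restrict (Icc 0 D)] P := by
  have hPi := hP.1.integrable
  have hQi := hQ.integrable
  have hPl := integrableOn_log_one_add hPi hP.1.nonneg
  have hQl := integrableOn_log_one_add hQi hQ.nonneg
  -- The subtracted term is linear with the slope of `log (1 + x)` at `c`; it makes `F` nonnegative
  -- and integrates to zero because the energies agree.
  set F : ℝ → ℝ := fun t =>
    Real.log (1 + Q t) - Real.log (1 + P t) - (Q t - P t) / (1 + c) with hF
  have hFi : IntegrableOn F (Icc 0 D) := (hQl.sub hPl).sub ((hQi.sub hPi).div_const _)
  have hFpos : ∀ t ∈ Icc 0 D, Q t ≠ P t → 0 < F t := by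
    intro t ht hne
    obtain ⟨w, hw, hQt⟩ := hw t ht
    have hw0 : w ≠ 0 := by rintro rfl; simp [hQt] at hne
    have hx : P t ≠ c := by intro h; simp [hQt, h] at hne
    have := sub_div_lt_log_sub_log (hP.1.nonneg t ht) hc (lt_of_le_of_ne hw.1 hw0.symm) hw.2 hx
    simp only [hF, hQt]
    rw [add_sub_cancel_left]
    linarith
  have hF0 : ∀ t ∈ Icc 0 D, 0 ≤ F t := by
    intro t ht
    by_cases h : Q t = P t
    · simp [hF, h]
    · exact (hFpos t ht h).le
  have hae : 0 ≤ᵐ[volume.restrict (Icc 0 D)] F :=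
    (ae_restrict_mem measurableSet_Icc).mono hF0
  have hthr : ∀ R : ℝ → ℝ,
      throughput D R = 1 / 2 * ((∫ t in Icc 0 D, Real.log (1 + R t)) / Real.log 2) := by
    intro R
    rw [throughput, intervalIntegral.integral_of_le hD, ← integral_Icc_eq_integral_Ioc,
      integral_const_mul]
    simp only [Real.logb, integral_div]
  have hle := hP.2 Q hQ
  rw [hthr, hthr] at hle
  have hle' : (∫ t in Icc 0 D, Real.log (1 + Q t)) ≤ ∫ t in Icc 0 D, Real.log (1 + P t) :=
    (div_le_div_iff_of_pos_right (Real.log_pos one_lt_two)).1 (by linarith)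
  rw [intervalIntegral.integral_of_le hD, intervalIntegral.integral_of_le hD,
    ← integral_Icc_eq_integral_Ioc, ← integral_Icc_eq_integral_Ioc] at hPQ
  have hval : (∫ t in Icc 0 D, F t) =
      (∫ t in Icc 0 D, Real.log (1 + Q t)) - (∫ t in Icc 0 D, Real.log (1 + P t)) := by
    have h1 : (∫ t in Icc 0 D, F t) = (∫ t in Icc 0 D, (Real.log (1 + Q t) - Real.log (1 + P t)))
        - ∫ t in Icc 0 D, (Q t - P t) / (1 + c) :=
      integral_sub (hQl.sub hPl) ((hQi.sub hPi).div_const _)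
    rw [h1, integral_sub hQl hPl, integral_div, integral_sub hQi hPi, hPQ]
    simp
  have hzero : (∫ t in Icc 0 D, F t) = 0 :=
    le_antisymm (by rw [hval]; linarith) (integral_nonneg_of_ae hae)
  have hFz := (integral_eq_zero_iff_of_nonneg_ae hae hFi).1 hzero
  filter_upwards [hFz, ae_restrict_mem measurableSet_Icc] with t ht htD
  by_contra hne
  exact (hFpos t htD hne).ne' ht

/-! ### From almost everywhere to points of continuity. -/

/-- Two functions agreeing almost everywhere on an interval agree at its points of continuity. -/
theorem eq_const_of_ae_of_continuousWithinAt {P : ℝ → ℝ} {s D c t : ℝ} (hsD : s < D)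
    (hP : ∀ᵐ τ ∂(volume.restrict (Icc s D)), P τ = c) (ht : t ∈ Icc s D)
    (hcont : ContinuousWithinAt P (Icc s D) t) : P t = c := by
  by_contra hne
  have h1 : ∀ᶠ τ in nhdsWithin t (Icc s D), P τ ≠ c := hcont.eventually_ne hne
  rw [eventually_nhdsWithin_iff, Metric.eventually_nhds_iff] at h1
  obtain ⟨δ, hδ, h⟩ := h1
  have hpos : 0 < volume (Ioo (max (t - δ) s) (min (t + δ) D)) := by
    rw [Real.volume_Ioo, ENNReal.ofReal_pos, sub_pos, max_lt_iff, lt_min_iff, lt_min_iff]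
    have := ht.1
    have := ht.2
    exact ⟨⟨by linarith, by linarith⟩, by linarith, hsD⟩
  rw [ae_restrict_iff' measurableSet_Icc, ae_iff] at hP
  refine hpos.ne' (measure_mono_null (fun x hx => ?_) hP)
  obtain ⟨h2, h3⟩ := hx
  rw [max_lt_iff] at h2
  rw [lt_min_iff] at h3
  have hx : x ∈ Icc s D := ⟨h2.2.le, h3.2.le⟩
  simp only [mem_ofPred_eq, not_forall]
  refine ⟨hx, h ?_ hx⟩
  rw [Real.dist_eq, abs_lt]
  constructor <;> linarith

/-! ### Energy compared with the holding power. -/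

/-- A policy heating from `Te` to `Tc` in finite time exceeds the power that holds `Tc`. -/
theorem integral_max_sub_pos {a b Te Tc s : ℝ} (ha : 0 < a) (hT : Te < Tc) (hs : 0 ≤ s)
    {P : ℝ → ℝ} (hP : IntervalIntegrable P volume 0 s) (htemp : temperature a b Te P s = Tc) :
    0 < ∫ τ in (0 : ℝ)..s, max (P τ - (Tc - Te) * b / a) 0 := by
  set c := (Tc - Te) * b / a with hc
  have hac : a * c = (Tc - Te) * b := by rw [hc]; field_simp
  have hmi : IntervalIntegrable (fun τ => max (P τ - c) 0) volume 0 s :=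
    ⟨(hP.1.sub (integrable_const c)).pos_part, (hP.2.sub (integrable_const c)).pos_part⟩
  refine lt_of_le_of_ne (intervalIntegral.integral_nonneg hs fun _ _ => le_max_right _ _) ?_
  intro h0
  have h1 := (intervalIntegral.integral_eq_zero_iff_of_le_of_nonneg_ae hs
    (Filter.Eventually.of_forall fun _ => le_max_right _ _) hmi).1 h0.symm
  -- With `P ≤ c` almost everywhere, the weighted heating falls short of the required `(Tc - Te) *
  -- exp (b * s)` by at least `Tc - Te`.
  have h2 : (∫ τ in (0 : ℝ)..s, Real.exp (b * τ) * (a * P τ)) ≤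
      ∫ τ in (0 : ℝ)..s, Real.exp (b * τ) * (b * (Tc - Te)) := by
    rw [intervalIntegral.integral_of_le hs, intervalIntegral.integral_of_le hs]
    refine integral_mono_ae (intervalIntegrable_exp_mul b (hP.const_mul a)).1
      (Continuous.intervalIntegrable (by fun_prop) 0 s).1 ?_
    filter_upwards [h1] with τ hτ
    have h3 : P τ ≤ c := by
      have := le_max_left (P τ - c) 0
      simp only [Pi.zero_apply] at hτ
      linarith
    have h4 := mul_le_mul_of_nonneg_left h3 ha.le
    exact mul_le_mul_of_nonneg_left (by linarith) (Real.exp_pos _).le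
  rw [integral_exp_mul_const, mul_zero, Real.exp_zero] at h2
  have h5 := (temperature_eq_iff a b Te Tc hP).1 htemp
  rw [← intervalIntegral.integral_const_mul] at h5
  simp only [mul_left_comm (a := Real.exp _)] at h2
  rw [h5] at h2
  linarith

/-- After the critical temperature is reached, the power holding that temperature spends at least
as much energy as any feasible policy. -/
theorem integral_sub_nonpos_of_temperature_le {a b Te Tc s D : ℝ} (ha : 0 < a) (hb : 0 ≤ b)
    (hs : 0 ≤ s) (hsD : s ≤ D) {P : ℝ → ℝ} (hP : IntervalIntegrable P volume 0 D)
    (htemp : temperature a b Te P s = Tc) (hle : ∀ t ∈ Icc 0 D, temperature a b Te P t ≤ Tc) :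
    (∫ τ in s..D, (P τ - (Tc - Te) * b / a)) ≤ 0 := by
  set c := (Tc - Te) * b / a with hc
  have hac : a * c = (Tc - Te) * b := by rw [hc]; field_simp
  have hsub : ∀ {x y : ℝ}, x ∈ Icc 0 D → y ∈ Icc 0 D → IntervalIntegrable P volume x y := by
    intro x y hx hy
    exact hP.mono_set (uIcc_subset_uIcc (by rwa [uIcc_of_le (hs.trans hsD)])
      (by rwa [uIcc_of_le (hs.trans hsD)]))
  have h0m : (0 : ℝ) ∈ Icc 0 D := ⟨le_rfl, hs.trans hsD⟩
  have hsm : s ∈ Icc 0 D := ⟨hs, hsD⟩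
  refine integral_nonpos_of_integral_exp_mul_nonpos hb hsD
    ((hsub hsm ⟨hs.trans hsD, le_rfl⟩).sub intervalIntegrable_const) fun t ht => ?_
  have htm : t ∈ Icc 0 D := ⟨hs.trans ht.1, ht.2⟩
  have h1 := (temperature_eq_iff a b Te Tc (hsub h0m hsm)).1 htemp
  have h2 := (temperature_le_iff a b Te Tc (hsub h0m htm)).1 (hle t htm)
  rw [← intervalIntegral.integral_add_adjacent_intervals
    (intervalIntegrable_exp_mul b (hsub h0m hsm)) (intervalIntegrable_exp_mul b (hsub hsm htm)),
    mul_add, h1] at h2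
  have h3 : a * (∫ τ in s..t, Real.exp (b * τ) * (P τ - c)) =
      a * (∫ τ in s..t, Real.exp (b * τ) * P τ) -
        (Tc - Te) * (Real.exp (b * t) - Real.exp (b * s)) := by
    rw [← integral_exp_mul_const b (Tc - Te) s t, ← intervalIntegral.integral_const_mul,
      ← intervalIntegral.integral_const_mul, ← intervalIntegral.integral_sub
      ((intervalIntegrable_exp_mul b (hsub hsm htm)).const_mul a)
      (Continuous.intervalIntegrable (by fun_prop) _ _)]
    congr 1
    ext τ
    linear_combination -Real.exp (b * τ) * hac
  exact nonpos_of_mul_nonpos_right (by rw [h3]; linarith) ha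

/-! ### The perturbed policy. -/

/-- Moving a policy towards the power `c` that holds the critical temperature: before the first
hitting time `s` only the power above `c` is reduced, afterwards the policy is averaged with `c`. -/
noncomputable def shift (c s θ ε : ℝ) (P : ℝ → ℝ) (t : ℝ) : ℝ :=
  if t ≤ s then P t - θ * max (P t - c) 0 else P t + ε * (c - P t)

section shift

variable {a b Te Tc E D c s θ ε : ℝ} {P : ℝ → ℝ}

theorem exists_shift_eq (hθ : θ ∈ Icc (0 : ℝ) 1) (hε : ε ∈ Icc (0 : ℝ) 1) (t : ℝ) :
    ∃ w ∈ Icc (0 : ℝ) 1, shift c s θ ε P t = P t + w * (c - P t) := by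
  unfold shift
  split_ifs with h
  · rcases le_total (P t) c with h1 | h1
    · exact ⟨0, by simp, by rw [max_eq_right (by linarith)]; ring⟩
    · exact ⟨θ, hθ, by rw [max_eq_left (by linarith)]; ring⟩
  · exact ⟨ε, hε, rfl⟩

theorem shift_nonneg (hc : 0 ≤ c) (hθ : θ ∈ Icc (0 : ℝ) 1) (hε : ε ∈ Icc (0 : ℝ) 1) {t : ℝ}
    (hP : 0 ≤ P t) : 0 ≤ shift c s θ ε P t := by
  obtain ⟨w, hw, h⟩ := exists_shift_eq (c := c) (s := s) (P := P) hθ hε t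
  rw [h]
  have h1 := mul_nonneg (sub_nonneg.2 hw.2) hP
  have h2 := mul_nonneg hw.1 hc
  linarith

theorem integrableOn_shift (hP : IntegrableOn P (Icc 0 D)) :
    IntegrableOn (shift c s θ ε P) (Icc 0 D) := by
  have hci : IntegrableOn (fun _ : ℝ => c) (Icc 0 D) := integrableOn_const (by simp)
  exact Integrable.piecewise (s := Iic s) measurableSet_Iic
    (Integrable.integrableOn (hP.sub ((hP.sub hci).pos_part.const_mul θ)))
    (Integrable.integrableOn (hP.add ((hci.sub hP).const_mul ε)))

theorem integral_shift (hs : 0 ≤ s) (hsD : s ≤ D) (hP : IntegrableOn P (Icc 0 D)) :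
    (∫ τ in (0 : ℝ)..D, shift c s θ ε P τ) = (∫ τ in (0 : ℝ)..D, P τ)
      - θ * (∫ τ in (0 : ℝ)..s, max (P τ - c) 0) - ε * ∫ τ in s..D, (P τ - c) := by
  have hD := hs.trans hsD
  have hsm : s ∈ uIcc 0 D := by rw [uIcc_of_le hD]; exact ⟨hs, hsD⟩
  have hPi : IntervalIntegrable P volume 0 D :=
    (intervalIntegrable_iff_integrableOn_Icc_of_le hD).2 hP
  have hQi : IntervalIntegrable (shift c s θ ε P) volume 0 D :=
    (intervalIntegrable_iff_integrableOn_Icc_of_le hD).2 (integrableOn_shift hP)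
  have hP1 := hPi.mono_set (uIcc_subset_uIcc_left hsm)
  have hP2 := hPi.mono_set (uIcc_subset_uIcc_right hsm)
  have hmi : IntervalIntegrable (fun τ => max (P τ - c) 0) volume 0 s :=
    ⟨(hP1.1.sub (integrable_const c)).pos_part, (hP1.2.sub (integrable_const c)).pos_part⟩
  rw [← intervalIntegral.integral_add_adjacent_intervals
      (hQi.mono_set (uIcc_subset_uIcc_left hsm)) (hQi.mono_set (uIcc_subset_uIcc_right hsm)),
    ← intervalIntegral.integral_add_adjacent_intervals hP1 hP2]
  have h1 : (∫ τ in (0 : ℝ)..s, shift c s θ ε P τ) =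
      ∫ τ in (0 : ℝ)..s, (P τ - θ * max (P τ - c) 0) := by
    refine intervalIntegral.integral_congr_ae (Filter.Eventually.of_forall ?_)
    intro x hx
    rw [uIoc_of_le hs] at hx
    exact if_pos hx.2
  have h2 : (∫ τ in s..D, shift c s θ ε P τ) = ∫ τ in s..D, (P τ - ε * (P τ - c)) := by
    refine intervalIntegral.integral_congr_ae (Filter.Eventually.of_forall ?_)
    intro x hx
    rw [uIoc_of_le hsD] at hx
    simp only [shift, if_neg (not_le.2 hx.1)]
    ring
  rw [h1, h2, intervalIntegral.integral_sub hP1 (hmi.const_mul θ),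
    intervalIntegral.integral_sub hP2 ((hP2.sub intervalIntegrable_const).const_mul ε),
    intervalIntegral.integral_const_mul, intervalIntegral.integral_const_mul]
  ring

/-- Up to `s` the power only drops. After `s` the added heat is a convex combination of that of `P`
and that of the constant `c`, each keeping the temperature at most `Tc` when started from `Tc` at
`s`. -/
theorem temperature_shift_le (ha : 0 ≤ a) (hac : a * c = (Tc - Te) * b) (hθ : 0 ≤ θ)
    (hε : ε ∈ Icc (0 : ℝ) 1) (hs : s ∈ Icc 0 D) (hP : IntegrableOn P (Icc 0 D))
    (htemp : temperature a b Te P s = Tc) (hle : ∀ t ∈ Icc 0 D, temperature a b Te P t ≤ Tc)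
    {t : ℝ} (ht : t ∈ Icc 0 D) : temperature a b Te (shift c s θ ε P) t ≤ Tc := by
  have hD : 0 ≤ D := hs.1.trans hs.2
  have hsub : ∀ {f : ℝ → ℝ}, IntegrableOn f (Icc 0 D) → ∀ {x y : ℝ}, x ∈ Icc 0 D → y ∈ Icc 0 D →
      IntervalIntegrable f volume x y := by
    intro f hf x y hx hy
    exact ((intervalIntegrable_iff_integrableOn_Icc_of_le hD).2 hf).mono_set
      (uIcc_subset_uIcc (by rwa [uIcc_of_le hD]) (by rwa [uIcc_of_le hD]))
  have hQ : IntegrableOn (shift c s θ ε P) (Icc 0 D) := integrableOn_shift hP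
  have h0 : (0 : ℝ) ∈ Icc 0 D := ⟨le_rfl, hD⟩
  have hearly : ∀ x ∈ Icc 0 s, a * (∫ τ in (0 : ℝ)..x, Real.exp (b * τ) * shift c s θ ε P τ) ≤
      a * ∫ τ in (0 : ℝ)..x, Real.exp (b * τ) * P τ := by
    intro x hx
    have hxD : x ∈ Icc 0 D := ⟨hx.1, hx.2.trans hs.2⟩
    refine mul_le_mul_of_nonneg_left (intervalIntegral.integral_mono_on hx.1
      (intervalIntegrable_exp_mul b (hsub hQ h0 hxD))
      (intervalIntegrable_exp_mul b (hsub hP h0 hxD)) fun τ hτ => ?_) ha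
    refine mul_le_mul_of_nonneg_left ?_ (Real.exp_pos _).le
    rw [shift, if_pos (hτ.2.trans hx.2)]
    have := mul_nonneg hθ (le_max_right (P τ - c) 0)
    linarith
  rw [temperature_le_iff a b Te Tc (hsub hQ h0 ht)]
  have hPt := (temperature_le_iff a b Te Tc (hsub hP h0 ht)).1 (hle t ht)
  rcases le_total t s with hts | hst
  · exact (hearly t ⟨ht.1, hts⟩).trans hPt
  have hPs := (temperature_eq_iff a b Te Tc (hsub hP h0 hs)).1 htemp
  have hQs := hearly s ⟨hs.1, le_rfl⟩
  rw [← intervalIntegral.integral_add_adjacent_intervals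
    (intervalIntegrable_exp_mul b (hsub hP h0 hs)) (intervalIntegrable_exp_mul b (hsub hP hs ht)),
    mul_add, hPs] at hPt
  rw [← intervalIntegral.integral_add_adjacent_intervals
    (intervalIntegrable_exp_mul b (hsub hQ h0 hs)) (intervalIntegrable_exp_mul b (hsub hQ hs ht)),
    mul_add]
  have hlate : a * (∫ τ in s..t, Real.exp (b * τ) * shift c s θ ε P τ) =
      (1 - ε) * (a * ∫ τ in s..t, Real.exp (b * τ) * P τ) +
        ε * ((Tc - Te) * (Real.exp (b * t) - Real.exp (b * s))) := by
    rw [← integral_exp_mul_const b (Tc - Te) s t]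
    simp only [← intervalIntegral.integral_const_mul]
    rw [← intervalIntegral.integral_add
      (((intervalIntegrable_exp_mul b (hsub hP hs ht)).const_mul a).const_mul _)
      (Continuous.intervalIntegrable (by fun_prop) _ _)]
    refine intervalIntegral.integral_congr_ae (Filter.Eventually.of_forall ?_)
    intro x hx
    rw [uIoc_of_le hst] at hx
    simp only [shift, if_neg (not_le.2 hx.1)]
    linear_combination ε * Real.exp (b * x) * hac
  rw [hlate]
  have := mul_le_mul_of_nonneg_left hPt (sub_nonneg.2 hε.2)
  linarith

end shift

/-! ### Conclusion from optimality. -/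

/-- An optimal policy holds the critical temperature by constant power once it is reached. -/
theorem IsOptimal.ae_eq_after_hitting {a b Te Tc E D : ℝ} (ha : 0 < a) (hb : 0 ≤ b) (hT : Te < Tc)
    {P : ℝ → ℝ} (hP : IsOptimal a b Te Tc E D P) {s : ℝ} (hs : s ∈ Icc 0 D)
    (htemp : temperature a b Te P s = Tc) :
    ∀ᵐ t ∂(volume.restrict (Icc s D)), P t = (Tc - Te) * b / a := by
  have hD : 0 ≤ D := hs.1.trans hs.2
  have hPi : IntervalIntegrable P volume 0 D :=
    (intervalIntegrable_iff_integrableOn_Icc_of_le hD).2 hP.1.integrable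
  have hsm : s ∈ uIcc 0 D := by rwa [uIcc_of_le hD]
  have hM := integral_max_sub_pos ha hT hs.1 (hPi.mono_set (uIcc_subset_uIcc_left hsm)) htemp
  have he := integral_sub_nonpos_of_temperature_le ha hb hs.1 hs.2 hPi htemp hP.1.temp
  set c := (Tc - Te) * b / a with hc
  have hac : a * c = (Tc - Te) * b := by rw [hc]; field_simp
  have hc0 : 0 ≤ c := div_nonneg (mul_nonneg (sub_nonneg.2 hT.le) hb) ha.le
  set M := ∫ τ in (0 : ℝ)..s, max (P τ - c) 0 with hMdef
  set e := ∫ τ in s..D, (P τ - c) with hedef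
  have hMe : 0 < M - e := by linarith
  -- These weights solve `θ * M + ε * e = 0` with `θ + ε = 1`, so the energy is preserved; `M > 0`
  -- gives `ε > 0`.
  have hθ : -e / (M - e) ∈ Icc (0 : ℝ) 1 :=
    ⟨div_nonneg (by linarith) hMe.le, (div_le_one hMe).2 (by linarith)⟩
  have hε0 : 0 < M / (M - e) := div_pos hM hMe
  have hε : M / (M - e) ∈ Icc (0 : ℝ) 1 := ⟨hε0.le, (div_le_one hMe).2 (by linarith)⟩
  have hQi : IntegrableOn (shift c s (-e / (M - e)) (M / (M - e)) P) (Icc 0 D) :=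
    integrableOn_shift hP.1.integrable
  have hQ0 : ∀ t ∈ Icc 0 D, 0 ≤ shift c s (-e / (M - e)) (M / (M - e)) P t :=
    fun t ht => shift_nonneg hc0 hθ hε (hP.1.nonneg t ht)
  have hQE : (∫ τ in (0 : ℝ)..D, shift c s (-e / (M - e)) (M / (M - e)) P τ) =
      ∫ τ in (0 : ℝ)..D, P τ := by
    rw [integral_shift hs.1 hs.2 hP.1.integrable, ← hMdef, ← hedef]
    field_simp
    ring
  have hQ : IsFeasible a b Te Tc E D (shift c s (-e / (M - e)) (M / (M - e)) P) := by
    refine ⟨hQi, hQ0, fun t ht => ?_, fun t ht =>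
      temperature_shift_le ha.le hac hθ.1 hε hs hP.1.integrable htemp hP.1.temp ht⟩
    -- With no later arrivals and nonnegative power, only the energy constraint at `D` matters.
    refine le_trans ?_ (hQE.le.trans (hP.1.energy D ⟨hD, le_rfl⟩))
    refine intervalIntegral.integral_mono_interval le_rfl ht.1 ht.2 ?_
      ((intervalIntegrable_iff_integrableOn_Icc_of_le hD).2 hQi)
    exact (ae_restrict_mem measurableSet_Ioc).mono fun x hx => hQ0 x ⟨hx.1.le, hx.2⟩
  have hae := hP.ae_eq_of_between hD hQ hQE hc0 fun t _ => exists_shift_eq hθ hε t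
  have hae' := ae_restrict_of_ae_restrict_of_subset (Icc_subset_Icc_left hs.1) hae
  -- At `t = s` the first branch of `shift` applies, so this endpoint is dropped.
  rw [← Measure.restrict_congr_set (Ioc_ae_eq_Icc (a := s) (b := D) (μ := volume))] at hae' ⊢
  filter_upwards [hae', ae_restrict_mem measurableSet_Ioc] with t ht hts
  rw [shift, if_neg (not_le.2 hts.1), add_eq_left, mul_eq_zero] at ht
  rcases ht with h | h
  · exact absurd h hε0.ne'
  · linarith

theorem temperature_eq_of_ae_eq {a b Te Tc s D : ℝ} (ha : 0 < a) (hs : s ∈ Icc 0 D) {P : ℝ → ℝ}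
    (hP : IntegrableOn P (Icc 0 D)) (htemp : temperature a b Te P s = Tc)
    (hae : ∀ᵐ t ∂(volume.restrict (Icc s D)), P t = (Tc - Te) * b / a) {t : ℝ}
    (ht : t ∈ Icc s D) : temperature a b Te P t = Tc := by
  have hD : 0 ≤ D := hs.1.trans hs.2
  have ht0 : t ∈ Icc 0 D := ⟨hs.1.trans ht.1, ht.2⟩
  have hPt : IntervalIntegrable P volume 0 t :=
    (intervalIntegrable_iff_integrableOn_Icc_of_le ht0.1).2
      (hP.mono_set (Icc_subset_Icc_right ht.2))
  have hsm : s ∈ uIcc 0 t := by rw [uIcc_of_le ht0.1]; exact ⟨hs.1, ht.1⟩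
  have hP1 := hPt.mono_set (uIcc_subset_uIcc_left hsm)
  have hP2 := hPt.mono_set (uIcc_subset_uIcc_right hsm)
  have h1 := (temperature_eq_iff a b Te Tc hP1).1 htemp
  have h2 : a * (∫ τ in s..t, Real.exp (b * τ) * P τ) =
      (Tc - Te) * (Real.exp (b * t) - Real.exp (b * s)) := by
    rw [← integral_exp_mul_const b (Tc - Te) s t, ← intervalIntegral.integral_const_mul]
    apply intervalIntegral.integral_congr_ae
    rw [ae_restrict_iff' measurableSet_Icc] at hae
    filter_upwards [hae] with x hx hxs
    rw [uIoc_of_le ht.1] at hxs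
    rw [hx ⟨hxs.1.le, hxs.2.trans ht.2⟩]
    field_simp
  rw [temperature_eq_iff a b Te Tc hPt, ← intervalIntegral.integral_add_adjacent_intervals
    (intervalIntegrable_exp_mul b hP1) (intervalIntegrable_exp_mul b hP2), mul_add, h1, h2]
  ring

end HeatTx

theorem lemma13 (a b Te Tc E D : ℝ) (ha : 0 ≤ a) (hb : 0 ≤ b) (hT : Te < Tc)
    (hE : 0 ≤ E) (hD : 0 < D) (P : ℝ → ℝ) (hP : HeatTx.IsOptimal a b Te Tc E D P)
    (t' : ℝ) (ht' : IsLeast {t ∈ Set.Icc 0 D | HeatTx.temperature a b Te P t = Tc} t')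
    (ht'D : t' < D) :
    (∀ᵐ t ∂(MeasureTheory.volume.restrict (Set.Icc t' D)), P t = (Tc - Te) * b / a) ∧
    (∀ t ∈ Set.Icc t' D, ContinuousWithinAt P (Set.Icc t' D) t → P t = (Tc - Te) * b / a) ∧
    (∀ t ∈ Set.Icc t' D, HeatTx.temperature a b Te P t = Tc) := by
  obtain ⟨⟨hs, htemp⟩, -⟩ := ht'
  have hPi := hP.1.integrable
  have ha' : 0 < a := by
    -- With `a = 0` the temperature would stay at `Te` and never reach `Tc`.
    refine lt_of_le_of_ne ha ?_
    rintro rfl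
    have h := HeatTx.temperature_eq 0 b Te
      ((intervalIntegrable_iff_integrableOn_Icc_of_le hs.1).2
        (hPi.mono_set (Set.Icc_subset_Icc_right hs.2)))
    rw [htemp, zero_mul, mul_zero, add_zero] at h
    exact hT.ne' h
  have hae := hP.ae_eq_after_hitting ha' hb hT hs htemp
  exact ⟨hae, fun t ht h => HeatTx.eq_const_of_ae_of_continuousWithinAt ht'D hae ht h,
    fun t ht => HeatTx.temperature_eq_of_ae_eq ha' hs hPi htemp hae ht⟩
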